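/- Let $\sigma \ge 2$ be a fixed alphabet size and let $c,\epsilon$ be constants with $1-\epsilon > c > \epsilon > 0$. A (one-pass, Standard-model) decompressor reads a bit string $e$ once from left to right, holds a bit string as its memory (the memory contents determine its next action), appends characters of a $\sigma$-letter alphabet one at a time to its output, and eventually halts; it recovers $s$ from $e$ if it halts on input $e$ with output exactly $s$. For a string $s$ of length $n$ and $k \ge 0$ let $$H_k(s) = \frac1n \sum_{|w|=k} |w_s|\, H_0(w_s), \qquad H_0(t) = \frac{1}{|t|}\sum_{a \in t} t_a \log_2 \frac{|t|}{t_a},$$ where $w_s$ is the concatenation of the characters that immediately follow the occurrences of $w$ in $s$, $t_a$ is the number of occurrences of the character $a$ in $t$, and the term of an empty $w_s$ is $0$. With $O(n^c)$ bits of memory, no decompressor can recover every string $s$ of length $n$ from $O(n H_k(s) + \sigma^k n^{1-c-\epsilon})$ bits, for $k = \lceil (c+\epsilon/2)\log_\sigma n\rceil$. Precisely: for all constants $C_1, C_2$ there is an $N$ such that for every $n \ge N$ and every decompressor $A$ there is a string $s$ of length $n$ over the $\sigma$-letter alphabet such that every bit string $e$ from which $A$ recovers $s$ while never holding more than $C_1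 n^c$ bits in memory has length greater than $$C_2\left(n H_k(s) + \sigma^k n^{1-c-\epsilon}\right), \qquad k = \lceil (c+\epsilon/2)\log_\sigma n\rceil .$$ -/

import Mathlib

open Filter

/-- One instruction of a one-pass decompressor over the alphabet `Fin σ`.  Memory contents are
bit strings, and every instruction names the new memory contents:
* `read next`: read the next bit of the input; the new memory is `next (some b)` if that bit is
  `b`, and `next none` if the input is exhausted (so the end of the input can be detected);
* `write a m`: append the character `a` to the output, the new memory is `m`;
* `compute m`: an internal step, the new memory is `m`;
* `halt`: stop. -/
inductive Instruction (σ : ℕ) : Type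
  | read (next : Option Bool → List Bool)
  | write (a : Fin σ) (m : List Bool)
  | compute (m : List Bool)
  | halt

/-- A deterministic decompressor in the one-pass streaming model with output alphabet `Fin σ`.
The memory contents (a bit string, which includes the state of the finite control) determine the
next instruction.  The input can only be read once, from left to right, and the output can only
be appended to. -/
structure Decompressor (σ : ℕ) : Type where
  /-- The initial memory contents. -/
  start : List Bool
  /-- The instruction that is executed for given memory contents. -/
  instr : List Bool → Instruction σ

namespace Decompressor

/-- An instantaneous description: memory contents, unread part of the input, output so far. -/
structure Config (σ : ℕ) : Type where
  memory : List Bool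
  input : List Bool
  output : List (Fin σ)

variable {σ : ℕ}

/-- The initial configuration on the input `e`. -/
def init (A : Decompressor σ) (e : List Bool) : Config σ :=
  ⟨A.start, e, []⟩

/-- One step of the computation; `none` means that the machine has halted. -/
def step (A : Decompressor σ) (x : Config σ) : Option (Config σ) :=
  match A.instr x.memory with
  | .read next => some ⟨next x.input.head?, x.input.tail, x.output⟩
  | .write a m => some ⟨m, x.input, x.output ++ [a]⟩
  | .compute m => some ⟨m, x.input, x.output⟩
  | .halt => none

/-- `x` is one of the configurations of the computation of `A` on the input `e`. -/
def Visits (A : Decompressor σ) (e : List Bool) (x : Config σ) : Prop :=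
  StateTransition.Reaches A.step (A.init e) x

/-- On the input `e` the decompressor `A` halts with output exactly `s`. -/
def Recovers (A : Decompressor σ) (e : List Bool) (s : List (Fin σ)) : Prop :=
  ∃ x, A.Visits e x ∧ A.step x = none ∧ x.output = s

/-- At no time during its computation on `e` does `A` hold more than `M` bits in memory. -/
def UsesMemoryAtMost (A : Decompressor σ) (e : List Bool) (M : ℝ) : Prop :=
  ∀ x, A.Visits e x → (x.memory.length : ℝ) ≤ M

end Decompressor

/-- The zeroth-order empirical entropy, in bits per character,
`H₀(s) = (1/n) ∑_{a ∈ s} n_a log₂ (n / n_a)`, where `n` is the length of `s` and `n_a` the number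
of occurrences of `a`; it is `0` for the empty string. -/
noncomputable def entropyZero {σ : ℕ} (s : List (Fin σ)) : ℝ :=
  (1 / (s.length : ℝ)) *
    ∑ a ∈ s.toFinset, (s.count a : ℝ) * Real.logb 2 ((s.length : ℝ) / (s.count a : ℝ))

/-- The string `w_s` of the characters that immediately follow the (possibly overlapping)
occurrences of `w` in `s`, in order. -/
def followers {σ : ℕ} (w s : List (Fin σ)) : List (Fin σ) :=
  (List.range s.length).filterMap fun i =>
    if (s.drop i).take w.length = w then s[i + w.length]? else none

/-- The `k`th-order empirical entropy `H_k(s) = (1/n) ∑_{|w| = k} |w_s| H₀(w_s)`, in bits per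
character, where `n` is the length of `s`.  For `k = 0` this is `entropyZero s`. -/
noncomputable def empiricalEntropy {σ : ℕ} (k : ℕ) (s : List (Fin σ)) : ℝ :=
  (1 / (s.length : ℝ)) *
    ∑ w : Fin k → Fin σ,
      ((followers (List.ofFn w) s).length : ℝ) * entropyZero (followers (List.ofFn w) s)

/-! The hard strings are prefixes of periodic strings whose period is a block of length `l` about
n^(c+ε/4), which is far more than the memory n^c and far less than σ^k, about n^(c+ε/2).

Since `l` is much smaller than σ^k, most blocks have few pairs of positions showing the same
k-window (`half_le_card_few_collisions`). A context without such a repetition always has the same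
follower and costs no entropy, so n H_k is at most a small constant times n
(`mul_empiricalEntropy_periodicPrefix_le`).

A decompressor, however, writes the block about n / l times. One of these copies is written while
few input bits are read, and it is determined by those bits and the memory at its start
(`Recovers.exists_block`). With only n / 8 input bits, memory and bits together are too few to
distinguish half of all blocks (`card_blocks_le`). As C₂(n H_k + σ^k n^(1-c-ε)) is below n / 8 for
large n, this gives the bound. -/

namespace Decompressor

/-! ### Computations of a decompressor and cheap blocks -/

variable {σ : ℕ}

theorem reaches_head (A : Decompressor σ) {x y z : Config σ} (h : A.step x = some y)
    (h' : StateTransition.Reaches A.step y z) : StateTransition.Reaches A.step x z :=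
  Relation.ReflTransGen.head h h'

/-- Along a computation the input is consumed from the left and the output grows to the right,
and only the consumed part of the input and the initial memory matter. -/
theorem reaches_consumed (A : Decompressor σ) {x y : Config σ}
    (h : StateTransition.Reaches A.step x y) :
    ∃ z q, x.input = z ++ y.input ∧ y.output = x.output ++ q ∧
      ∀ o, StateTransition.Reaches A.step ⟨x.memory, z, o⟩ ⟨y.memory, [], o ++ q⟩ := by
  induction h using Relation.ReflTransGen.head_induction_on with
  | refl => exact ⟨[], [], by simp, by simp, fun o => by
      rw [List.append_nil]; exact Relation.ReflTransGen.refl⟩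
  | @head a b hab hb ih =>
    obtain ⟨z, q, hz, hq, hr⟩ := ih
    obtain ⟨m, u, o⟩ := a
    simp only [step, Option.mem_def] at hab
    split at hab
    · rename_i next hi
      simp only [Option.some.injEq] at hab
      subst hab
      cases u with
      | nil =>
        -- At the end of the input the consumed part is empty too, so the replay also reads `none`.
        simp only [List.tail_nil, List.head?_nil] at hz hr
        have hz' := List.append_eq_nil_iff.1 hz.symm
        obtain ⟨rfl, hy⟩ := hz'
        refine ⟨[], q, by simp [hy], hq, fun o' => ?_⟩
        refine A.reaches_head ?_ (hr o')
        simp only [step]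
        rw [hi]; simp
      | cons b u =>
        simp only [List.tail_cons, List.head?_cons] at hz hr
        refine ⟨b :: z, q, by simp [hz], hq, fun o' => ?_⟩
        refine A.reaches_head ?_ (hr o')
        simp only [step]
        rw [hi]; simp
    · rename_i a m' hi
      simp only [Option.some.injEq] at hab
      subst hab
      refine ⟨z, a :: q, hz, by simp [hq], fun o' => ?_⟩
      refine A.reaches_head (y := ⟨m', z, o' ++ [a]⟩) ?_ (by simpa using hr (o' ++ [a]))
      simp only [step]
      rw [hi]
    · rename_i m' hi
      simp only [Option.some.injEq] at hab
      subst hab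
      refine ⟨z, q, hz, hq, fun o' => ?_⟩
      refine A.reaches_head (y := ⟨m', z, o'⟩) ?_ (hr o')
      simp only [step]
      rw [hi]
    · cases hab

theorem output_length_step (A : Decompressor σ) {x y : Config σ} (h : y ∈ A.step x) :
    y.output.length ≤ x.output.length + 1 := by
  simp only [step, Option.mem_def] at h
  split at h <;> simp_all <;> subst h <;> simp

/-- Every intermediate output length is attained during a computation. -/
theorem exists_output_length (A : Decompressor σ) {x y : Config σ}
    (h : StateTransition.Reaches A.step x y) {j : ℕ} (hx : x.output.length ≤ j)
    (hy : j ≤ y.output.length) :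
    ∃ z, StateTransition.Reaches A.step x z ∧ StateTransition.Reaches A.step z y ∧
      z.output.length = j := by
  induction h using Relation.ReflTransGen.head_induction_on with
  | refl => exact ⟨y, .refl, .refl, by omega⟩
  | @head a b hab hb ih =>
    by_cases hj : a.output.length = j
    · exact ⟨a, .refl, .head hab hb, hj⟩
    · have := output_length_step A hab
      obtain ⟨z, h1, h2, h3⟩ := ih (by omega)
      exact ⟨z, .head hab h1, h2, h3⟩

/-- While `p` blocks of `l` characters are written, some block is written with at most a `p`-th
part of the input being read. -/
theorem exists_cheap_block (A : Decompressor σ) (l p : ℕ) (hp : 1 ≤ p) {x y : Config σ}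
    (h : StateTransition.Reaches A.step x y)
    (hy : x.output.length + p * l ≤ y.output.length) :
    ∃ i u v, i < p ∧ StateTransition.Reaches A.step x u ∧ StateTransition.Reaches A.step u v ∧
      StateTransition.Reaches A.step v y ∧ u.output.length = x.output.length + i * l ∧
      v.output.length = u.output.length + l ∧
      p * (u.input.length - v.input.length) ≤ x.input.length := by
  induction p, hp using Nat.le_induction generalizing x with
  | base =>
    obtain ⟨v, h1, h2, h3⟩ := exists_output_length A h (j := x.output.length + l) (by omega)
      (by omega)
    exact ⟨0, x, v, by omega, .refl, h1, h2, by simp, h3, by omega⟩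
  | succ p hp ih =>
    have hmul : (p + 1) * l = p * l + l := by ring
    obtain ⟨v, h1, h2, h3⟩ := exists_output_length A h (j := x.output.length + l) (by omega)
      (by omega)
    by_cases hc : (p + 1) * (x.input.length - v.input.length) ≤ x.input.length
    · exact ⟨0, x, v, by omega, .refl, h1, h2, by simp, h3, hc⟩
    -- An expensive first block leaves less than p / (p + 1) of the input for the other `p` blocks,
    -- so a p-th part of the rest is within budget.
    · obtain ⟨i, u, w, hi, g1, g2, g3, g4, g5, g6⟩ := ih h2 (by omega)
      refine ⟨i + 1, u, w, by omega, h1.trans g1, g2, g3, by rw [g4, h3]; ring, g5, ?_⟩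
      obtain ⟨z, q, hz, -, -⟩ := reaches_consumed A h1
      have hlen : x.input.length = z.length + v.input.length := by rw [hz]; simp
      have hd : x.input.length - v.input.length = z.length := by omega
      rw [hd] at hc
      push Not at hc
      set d := u.input.length - w.input.length
      by_contra hcon
      push Not at hcon
      have e1 : (p + 1) * (p * d) ≤ (p + 1) * v.input.length := Nat.mul_le_mul_left _ g6
      have e2 : p * (x.input.length + 1) ≤ p * ((p + 1) * d) := Nat.mul_le_mul_left _ hcon
      nlinarith

/-- Bits and memory determine the characters that are written. -/
theorem output_unique (A : Decompressor σ) {x y y' : Config σ}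
    (h : StateTransition.Reaches A.step x y) (h' : StateTransition.Reaches A.step x y')
    (hl : y.output.length = y'.output.length) : y.output = y'.output := by
  rcases StateTransition.reaches_total h h' with g | g
  · obtain ⟨z, q, -, hq, -⟩ := reaches_consumed A g
    have : q = [] := by
      have := congrArg List.length hq
      simp only [List.length_append] at this
      exact List.length_eq_zero_iff.1 (by omega)
    simp [hq, this]
  · obtain ⟨z, q, -, hq, -⟩ := reaches_consumed A g
    have : q = [] := by
      have := congrArg List.length hq
      simp only [List.length_append] at this
      exact List.length_eq_zero_iff.1 (by omega)
    simp [hq, this]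

/-- If `A` recovers a string from `e`, then one of the first `p` blocks of length `l` of that
string is determined by memory contents of `A` and at most `e.length / p` bits. -/
theorem Recovers.exists_block (A : Decompressor σ) {l p M : ℕ} (hp : 1 ≤ p) {e : List Bool}
    {s : List (Fin σ)} (h : A.Recovers e s) (hM : A.UsesMemoryAtMost e M)
    (hs : p * l ≤ s.length) :
    ∃ i m z m', i < p ∧ m.length ≤ M ∧ z.length ≤ e.length / p ∧
      StateTransition.Reaches A.step ⟨m, z, []⟩ ⟨m', [], (s.drop (i * l)).take l⟩ := by
  obtain ⟨y, hy, -, rfl⟩ := h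
  obtain ⟨i, u, v, hi, h1, h2, h3, h4, h5, h6⟩ :=
    exists_cheap_block A l p hp hy (by simpa [init] using hs)
  obtain ⟨z, q, hz, hq, hr⟩ := reaches_consumed A h2
  obtain ⟨z', q', -, hq', -⟩ := reaches_consumed A h3
  have hu : u.output.length = i * l := by simpa [init] using h4
  have hql : q.length = l := by
    have := congrArg List.length hq
    simp only [List.length_append] at this
    omega
  refine ⟨i, u.memory, z, v.memory, hi, by exact_mod_cast hM u h1, ?_, ?_⟩
  · rw [Nat.le_div_iff_mul_le hp]
    have : u.input.length - v.input.length = z.length := by rw [hz]; simp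
    rw [this] at h6
    simpa [init, mul_comm] using h6
  · have : (y.output.drop (i * l)).take l = q := by
      rw [hq', hq, List.append_assoc, ← hu, List.drop_left, ← hql, List.take_left]
    rw [this]
    simpa using hr []

end Decompressor

/-! ### Counting recoverable blocks -/

/-- There are fewer than `2 ^ (L + 1)` bit strings of length at most `L`. -/
theorem exists_finset_bitStrings (L : ℕ) :
    ∃ S : Finset (List Bool), S.card ≤ 2 ^ (L + 1) ∧ ∀ z : List Bool, z.length ≤ L → z ∈ S := by
  classical
  refine ⟨(Finset.range (L + 1)).biUnion
    fun i => Finset.univ.image (List.ofFn : (Fin i → Bool) → List Bool), ?_, ?_⟩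
  · refine Finset.card_biUnion_le.trans ?_
    calc _ ≤ ∑ i ∈ Finset.range (L + 1), 2 ^ i := by
            refine Finset.sum_le_sum fun i _ => Finset.card_image_le.trans ?_
            simp
      _ ≤ 2 ^ (L + 1) := by
            rw [Nat.geomSum_eq le_rfl]; simp
  · intro z hz
    simp only [Finset.mem_biUnion, Finset.mem_range, Finset.mem_image, Finset.mem_univ, true_and]
    exact ⟨z.length, by omega, z.get, List.ofFn_get z⟩

/-- If strings `s r` repeating a block `r` at least `p` times are all recovered with memory `M` from
at most `B` bits, then there are at most `2 ^ (M + 1) * 2 ^ (B / p + 1)` blocks. -/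
theorem Decompressor.card_blocks_le {σ l p M B : ℕ} (A : Decompressor σ) (hp : 1 ≤ p)
    (G : Finset (Fin l → Fin σ)) (s : (Fin l → Fin σ) → List (Fin σ))
    (hlen : ∀ r, p * l ≤ (s r).length)
    (hs : ∀ r, ∀ i < p, ((s r).drop (i * l)).take l = List.ofFn r)
    (h : ∀ r ∈ G, ∃ e : List Bool, e.length ≤ B ∧ A.Recovers e (s r) ∧ A.UsesMemoryAtMost e M) :
    G.card ≤ 2 ^ (M + 1) * 2 ^ (B / p + 1) := by
  obtain ⟨S, hS, hS'⟩ := exists_finset_bitStrings M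
  obtain ⟨T, hT, hT'⟩ := exists_finset_bitStrings (B / p)
  -- Blocks outside `G` receive a dummy pair, so that `choose` gives a total function.
  have key : ∀ r, ∃ x : List Bool × List Bool, r ∈ G → x ∈ S ×ˢ T ∧
      ∃ m', StateTransition.Reaches A.step ⟨x.1, x.2, []⟩ ⟨m', [], List.ofFn r⟩ := by
    intro r
    by_cases hr : r ∈ G
    · obtain ⟨e, he, hR, hU⟩ := h r hr
      obtain ⟨i, m, z, m', hi, hm, hz, hreach⟩ := hR.exists_block A hp hU (hlen r)
      rw [hs r i hi] at hreach
      refine ⟨(m, z), fun _ => ⟨Finset.mem_product.2 ⟨hS' _ hm, hT' _ ?_⟩, m', hreach⟩⟩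
      exact hz.trans (Nat.div_le_div_right he)
    · exact ⟨([], []), fun h => absurd h hr⟩
  choose f hf using key
  calc G.card ≤ (S ×ˢ T).card := by
        refine Finset.card_le_card_of_injOn f (fun r hr => (hf r hr).1) ?_
        intro r hr r' hr' hff
        obtain ⟨m, hm⟩ := (hf r hr).2
        obtain ⟨m', hm'⟩ := (hf r' hr').2
        rw [hff] at hm
        exact List.ofFn_injective (A.output_unique hm hm' (by simp))
    _ ≤ _ := by rw [Finset.card_product]; exact Nat.mul_le_mul hS hT

/-! ### Periodic strings and collisions of windows -/

/-- The periodic sequence with period block `r`. -/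
def periodicSeq {α : Type*} {l : ℕ} [NeZero l] (r : Fin l → α) (i : ℕ) : α :=
  r (Fin.ofNat l i)

section Periodic

variable {α : Type*} {l : ℕ} [NeZero l] (r : Fin l → α)

theorem periodicSeq_congr {i j : ℕ} (h : i % l = j % l) : periodicSeq r i = periodicSeq r j := by
  unfold periodicSeq
  congr 1
  exact Fin.ext h

theorem periodicSeq_fin (a : Fin l) : periodicSeq r a = r a := by
  unfold periodicSeq
  congr 1
  exact Fin.ext (Nat.mod_eq_of_lt a.2)

/-- The first `n` characters of the periodic sequence. -/
def periodicPrefix (n : ℕ) : List α := (List.range n).map (periodicSeq r)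

@[simp]
theorem length_periodicPrefix (n : ℕ) : (periodicPrefix r n).length = n := by
  simp [periodicPrefix]

theorem take_drop_periodicPrefix {n i k : ℕ} (h : i + k ≤ n) :
    ((periodicPrefix r n).drop i).take k = List.ofFn fun t : Fin k => periodicSeq r (i + t) := by
  apply List.ext_getElem
  · simp; omega
  · intro t h1 h2
    simp [periodicPrefix]

theorem block_periodicPrefix {n i p : ℕ} (hp : p * l ≤ n) (hi : i < p) :
    ((periodicPrefix r n).drop (i * l)).take l = List.ofFn r := by
  have : (i + 1) * l ≤ p * l := Nat.mul_le_mul_right _ hi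
  rw [take_drop_periodicPrefix r (by linarith)]
  congr 1
  funext t
  rw [← periodicSeq_fin r t]
  apply periodicSeq_congr
  simp

/-- Pairs of different positions in the period at which the same `k` characters are read. -/
def collisions [DecidableEq α] (k : ℕ) : Finset (Fin l × Fin l) :=
  Finset.univ.filter fun x =>
    x.1 ≠ x.2 ∧ ∀ t < k, periodicSeq r (x.1 + t) = periodicSeq r (x.2 + t)

end Periodic

/-! ### Collisions in an average block -/

section Counting

variable {σ l : ℕ} [NeZero l]

/-- Each character of the second window is a copy of the one `d` places before it, so the `l - k`
characters outside that window determine the block. The windows may overlap; recovering characters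
from left to right handles this. -/
theorem card_shift_collision_le (i : ℕ) {d k : ℕ} (hd : 0 < d) (hk : d + k ≤ l) :
    (Finset.univ.filter fun r : Fin l → Fin σ =>
      ∀ t < k, periodicSeq r (i + t) = periodicSeq r (i + d + t)).card ≤ σ ^ (l - k) := by
  have hcard : (Finset.univ : Finset (Fin (l - k) → Fin σ)).card = σ ^ (l - k) := by simp
  rw [← hcard]
  refine Finset.card_le_card_of_injOn
    (fun r x => periodicSeq r (i + if (x : ℕ) < d then (x : ℕ) else x + k)) (by simp) ?_
  intro r hr r' hr' hrr
  simp only [Finset.coe_filter, Finset.mem_univ, true_and, Set.mem_ofPred_eq] at hr hr'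
  have main : ∀ x, x < l → periodicSeq r (i + x) = periodicSeq r' (i + x) := by
    intro x
    induction x using Nat.strong_induction_on with
    | _ x ih =>
      intro hx
      by_cases h1 : x < d
      · have := congrFun hrr ⟨x, by omega⟩
        simpa [h1] using this
      · by_cases h2 : x < d + k
        · have e : i + x = i + d + (x - d) := by omega
          rw [e, ← hr _ (by omega), ← hr' _ (by omega)]
          exact ih _ (by omega) (by omega)
        · have := congrFun hrr ⟨x - k, by omega⟩
          have h3 : ¬ x - k < d := by omega
          have h4 : x - k + k = x := by omega
          simpa [h3, h4] using this
  have hl : 0 < l := NeZero.pos l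
  funext a
  -- Modulo `l`, `i * (l - 1)` is `-i`, so this is the offset from `i` at which position `a` lies.
  have e : (i + (a + i * (l - 1)) % l) % l = a % l := by
    rw [Nat.add_mod_mod]
    have : i + (a + i * (l - 1)) = a + i * l := by
      obtain ⟨l', rfl⟩ : ∃ l', l = l' + 1 := ⟨l - 1, by omega⟩
      simp; ring
    rw [this]; simp
  have := main ((a + i * (l - 1)) % l) (Nat.mod_lt _ hl)
  rwa [periodicSeq_congr r e, periodicSeq_congr r' e, periodicSeq_fin, periodicSeq_fin] at this

/-- If the window at `j` runs cyclically past `i`, measure the shift from `j` round to `i` instead;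
`2 * k ≤ l` ensures that one of the two directions fits in a period. -/
theorem card_collision_le_of_lt {i j k : ℕ} (hij : i < j) (hj : j < l) (hk : 2 * k ≤ l) :
    (Finset.univ.filter fun r : Fin l → Fin σ =>
      ∀ t < k, periodicSeq r (i + t) = periodicSeq r (j + t)).card ≤ σ ^ (l - k) := by
  by_cases h : j - i + k ≤ l
  · have := card_shift_collision_le (σ := σ) i (d := j - i) (by omega) h
    rwa [show i + (j - i) = j by omega] at this
  · have := card_shift_collision_le (σ := σ) (l := l) j (d := l + i - j) (k := k) (by omega) (by omega)
    rw [show j + (l + i - j) = l + i by omega] at this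
    refine le_trans (Finset.card_le_card ?_) this
    intro r
    simp only [Finset.mem_filter, Finset.mem_univ, true_and]
    intro hr t ht
    rw [← hr t ht]
    apply periodicSeq_congr
    rw [add_assoc, Nat.add_mod_left]

theorem card_collision_le {i j : Fin l} {k : ℕ} (hij : i ≠ j) (hk : 2 * k ≤ l) :
    (Finset.univ.filter fun r : Fin l → Fin σ =>
      ∀ t < k, periodicSeq r (i + t) = periodicSeq r (j + t)).card ≤ σ ^ (l - k) := by
  rcases lt_or_gt_of_ne hij with h | h
  · exact card_collision_le_of_lt h j.2 hk
  · simp_rw [eq_comm (a := periodicSeq _ (i + _))]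
    exact card_collision_le_of_lt h i.2 hk

/-- Double counting: each of the at most `l ^ 2` pairs of positions collides in at most `σ ^ (l -
k)` blocks. -/
theorem sum_card_collisions_le {k : ℕ} (hk : 2 * k ≤ l) :
    ∑ r : Fin l → Fin σ, (collisions r k).card ≤ l ^ 2 * σ ^ (l - k) := by
  classical
  have e := Finset.sum_card_bipartiteAbove_eq_sum_card_bipartiteBelow
    (s := (Finset.univ : Finset (Fin l → Fin σ))) (t := (Finset.univ : Finset (Fin l × Fin l)))
    (fun r x => x.1 ≠ x.2 ∧ ∀ t < k, periodicSeq r (x.1 + t) = periodicSeq r (x.2 + t))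
  calc _ = _ := by
        refine Eq.trans ?_ e
        refine Finset.sum_congr rfl fun r _ => ?_
        congr 1
    _ ≤ ∑ x : Fin l × Fin l, σ ^ (l - k) := by
        refine Finset.sum_le_sum fun x _ => ?_
        by_cases hx : x.1 = x.2
        · simp [Finset.bipartiteBelow, hx]
        · refine le_trans (Finset.card_le_card ?_) (card_collision_le hx hk)
          intro r
          simp only [Finset.bipartiteBelow, Finset.mem_filter, Finset.mem_univ, true_and]
          exact fun h => h.2
    _ = _ := by simp [sq]

/-- Most blocks have few collisions. -/
theorem half_le_card_few_collisions {k : ℕ} (hk : 2 * k ≤ l) {η : ℝ} (hη : 0 < η)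
    (hl : 2 * (l : ℝ) ≤ η * (σ : ℝ) ^ k) :
    (σ : ℝ) ^ l ≤ 2 *
      ((Finset.univ.filter fun r : Fin l → Fin σ => ((collisions r k).card : ℝ) ≤ η * l).card : ℝ)
      := by
  classical
  set P : (Fin l → Fin σ) → Prop := fun r => ((collisions r k).card : ℝ) ≤ η * l with hP
  have hl0 : (0 : ℝ) < l := by exact_mod_cast NeZero.pos l
  have htot := Finset.card_filter_add_card_filter_not (s := (Finset.univ : Finset (Fin l → Fin σ))) P
  simp only [Finset.card_univ, Fintype.card_pi, Fintype.card_fin, Finset.prod_const] at htot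
  have htot' : ((Finset.univ.filter P).card : ℝ) + ((Finset.univ.filter fun r => ¬ P r).card : ℝ)
      = (σ : ℝ) ^ l := by exact_mod_cast htot
  -- Markov's inequality for the number of collisions.
  have hsum : (η * l) * ((Finset.univ.filter fun r => ¬ P r).card : ℝ)
      ≤ (l : ℝ) ^ 2 * (σ : ℝ) ^ (l - k) := by
    calc _ = ∑ r ∈ Finset.univ.filter (fun r => ¬ P r), η * l := by
          rw [Finset.sum_const, nsmul_eq_mul, mul_comm]
      _ ≤ ∑ r ∈ Finset.univ.filter (fun r => ¬ P r), ((collisions r k).card : ℝ) := by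
          refine Finset.sum_le_sum fun r hr => ?_
          exact (not_le.1 (Finset.mem_filter.1 hr).2).le
      _ ≤ ∑ r, ((collisions r k).card : ℝ) :=
          Finset.sum_le_sum_of_subset_of_nonneg (Finset.filter_subset _ _) (fun _ _ _ => by positivity)
      _ ≤ _ := by exact_mod_cast sum_card_collisions_le hk
  have hpow : (σ : ℝ) ^ l = (σ : ℝ) ^ k * (σ : ℝ) ^ (l - k) := by
    rw [← pow_add]; congr 1; omega
  have h2 : (η * l) * (2 * ((Finset.univ.filter fun r => ¬ P r).card : ℝ)) ≤ (η * l) * (σ : ℝ) ^ l := by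
    calc _ ≤ 2 * ((l : ℝ) ^ 2 * (σ : ℝ) ^ (l - k)) := by linarith
      _ = (2 * (l : ℝ)) * (l * (σ : ℝ) ^ (l - k)) := by ring
      _ ≤ (η * (σ : ℝ) ^ k) * (l * (σ : ℝ) ^ (l - k)) := by gcongr
      _ = _ := by rw [hpow]; ring
  have h3 := le_of_mul_le_mul_left h2 (by positivity)
  linarith

end Counting

/-! ### Empirical entropy of periodic strings -/

section Entropy

variable {σ : ℕ}

theorem entropyZero_nonneg (s : List (Fin σ)) : 0 ≤ entropyZero s := by
  unfold entropyZero
  refine mul_nonneg (by positivity) (Finset.sum_nonneg fun a ha => ?_)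
  have hc : 0 < s.count a := List.count_pos_iff.2 (List.mem_toFinset.1 ha)
  have hc' : (0 : ℝ) < s.count a := by exact_mod_cast hc
  refine mul_nonneg hc'.le (Real.logb_nonneg one_lt_two ?_)
  rw [le_div_iff₀ hc', one_mul]
  exact_mod_cast List.count_le_length

theorem empiricalEntropy_nonneg (k : ℕ) (s : List (Fin σ)) : 0 ≤ empiricalEntropy k s := by
  unfold empiricalEntropy
  exact mul_nonneg (by positivity)
    (Finset.sum_nonneg fun w _ => mul_nonneg (by positivity) (entropyZero_nonneg _))

/-- A crude upper bound, sufficient up to constants. -/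
theorem length_mul_entropyZero_le (s : List (Fin σ)) :
    (s.length : ℝ) * entropyZero s ≤ 2 * σ * s.length := by
  rcases Nat.eq_zero_or_pos s.length with h0 | h0
  · simp [h0]
  have h0' : (0 : ℝ) < s.length := by exact_mod_cast h0
  unfold entropyZero
  rw [← mul_assoc, mul_one_div_cancel h0'.ne', one_mul]
  calc _ ≤ ∑ a ∈ s.toFinset, 2 * (s.length : ℝ) := by
        refine Finset.sum_le_sum fun a ha => ?_
        have hc : 0 < s.count a := List.count_pos_iff.2 (List.mem_toFinset.1 ha)
        have hc' : (0 : ℝ) < s.count a := by exact_mod_cast hc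
        have hlog := Real.log_le_sub_one_of_pos (x := (s.length : ℝ) / s.count a) (by positivity)
        have h2 : (1 / 2 : ℝ) ≤ Real.log 2 := by linarith [Real.log_two_gt_d9]
        have : Real.logb 2 ((s.length : ℝ) / s.count a) ≤ 2 * ((s.length : ℝ) / s.count a) := by
          unfold Real.logb
          rw [div_le_iff₀ (by linarith)]
          have : (0 : ℝ) ≤ (s.length : ℝ) / s.count a := by positivity
          nlinarith
        calc _ ≤ (s.count a : ℝ) * (2 * ((s.length : ℝ) / s.count a)) := by gcongr
          _ = _ := by field_simp
    _ = (s.toFinset.card : ℝ) * (2 * s.length) := by rw [Finset.sum_const, nsmul_eq_mul]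
    _ ≤ (σ : ℝ) * (2 * s.length) := by
        gcongr
        simpa using s.toFinset.card_le_univ
    _ = _ := by ring

theorem entropyZero_eq_zero_of_const {s : List (Fin σ)} (h : ∀ a ∈ s, ∀ b ∈ s, a = b) :
    entropyZero s = 0 := by
  unfold entropyZero
  rw [Finset.sum_eq_zero, mul_zero]
  intro a ha
  have : s.count a = s.length := by
    rw [List.count_eq_length]
    exact fun b hb => h a (List.mem_toFinset.1 ha) b hb
  rw [this]
  have hpos : (0 : ℝ) < s.length := by
    exact_mod_cast List.length_pos_of_mem (List.mem_toFinset.1 ha)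
  rw [div_self hpos.ne', Real.logb_one, mul_zero]

theorem mem_followers {w s : List (Fin σ)} {a : Fin σ} :
    a ∈ followers w s ↔
      ∃ i, (s.drop i).take w.length = w ∧ s[i + w.length]? = some a := by
  unfold followers
  simp only [List.mem_filterMap, List.mem_range, Option.ite_none_right_eq_some]
  constructor
  · rintro ⟨i, -, h⟩; exact ⟨i, h⟩
  · rintro ⟨i, h1, h2⟩
    refine ⟨i, ?_, h1, h2⟩
    have := (List.getElem?_eq_some_iff.1 h2).1
    omega

theorem length_followers_le (w s : List (Fin σ)) :
    (followers w s).length ≤ ((Finset.range s.length).filter fun i =>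
      (s.drop i).take w.length = w ∧ i + w.length < s.length).card := by
  have : (followers w s).length = ((List.range s.length).filter fun i =>
      decide ((s.drop i).take w.length = w ∧ i + w.length < s.length)).length := by
    unfold followers
    rw [List.length_filterMap_eq_countP, List.countP_eq_length_filter]
    congr 1
    apply List.filter_congr
    intro i _
    by_cases h : (s.drop i).take w.length = w <;> by_cases h' : i + w.length < s.length <;>
      simp [h, h']
  rw [this]
  rfl

section Periodic

variable {l : ℕ} [NeZero l] (r : Fin l → Fin σ)

theorem getElem?_periodicPrefix {n i : ℕ} {a : Fin σ} (h : (periodicPrefix r n)[i]? = some a) :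
    i < n ∧ periodicSeq r i = a := by
  obtain ⟨h1, h2⟩ := List.getElem?_eq_some_iff.1 h
  refine ⟨by simpa using h1, ?_⟩
  simpa [periodicPrefix] using h2

/-- The positions in the period that take part in a collision. -/
def badPositions (k : ℕ) : Finset (Fin l) := (collisions r k).image Prod.fst

theorem window_eq_iff {n i j k : ℕ} {w : Fin k → Fin σ} (hi : i + k ≤ n)
    (h : ((periodicPrefix r n).drop i).take k = List.ofFn w) (hj : j + k ≤ n)
    (h' : ((periodicPrefix r n).drop j).take k = List.ofFn w) :
    ∀ t < k, periodicSeq r (i + t) = periodicSeq r (j + t) := by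
  rw [take_drop_periodicPrefix r hi] at h
  rw [take_drop_periodicPrefix r hj] at h'
  have := List.ofFn_injective (h.trans h'.symm)
  intro t ht
  exact congrFun this ⟨t, ht⟩

theorem mem_badPositions_of_window {i j k : ℕ} (hij : i % l ≠ j % l)
    (h : ∀ t < k, periodicSeq r (i + t) = periodicSeq r (j + t)) :
    Fin.ofNat l i ∈ badPositions r k := by
  refine Finset.mem_image.2 ⟨(Fin.ofNat l i, Fin.ofNat l j), ?_, rfl⟩
  simp only [collisions, Finset.mem_filter, Finset.mem_univ, true_and]
  refine ⟨fun e => hij (congrArg Fin.val e), fun t ht => ?_⟩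
  refine Eq.trans ?_ ((h t ht).trans ?_) <;> exact periodicSeq_congr r (by simp)

/-- A context with a single follower character costs nothing. Otherwise two of its occurrences are
incongruent modulo `l`; every occurrence is incongruent to one of these two, hence lies at a bad
position. -/
theorem length_mul_entropyZero_followers_le (n k : ℕ) (w : Fin k → Fin σ) :
    ((followers (List.ofFn w) (periodicPrefix r n)).length : ℝ) *
        entropyZero (followers (List.ofFn w) (periodicPrefix r n)) ≤
      2 * σ * (((Finset.range n).filter fun i => Fin.ofNat l i ∈ badPositions r k).filter fun i =>
        ((periodicPrefix r n).drop i).take k = List.ofFn w).card := by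
  by_cases hconst : ∀ a ∈ followers (List.ofFn w) (periodicPrefix r n),
      ∀ b ∈ followers (List.ofFn w) (periodicPrefix r n), a = b
  · rw [entropyZero_eq_zero_of_const hconst, mul_zero]
    positivity
  · push Not at hconst
    obtain ⟨a, ha, b, hb, hab⟩ := hconst
    rw [mem_followers, List.length_ofFn] at ha hb
    obtain ⟨i, hi, hi'⟩ := ha
    obtain ⟨j, hj, hj'⟩ := hb
    obtain ⟨hin, hia⟩ := getElem?_periodicPrefix r hi'
    obtain ⟨hjn, hjb⟩ := getElem?_periodicPrefix r hj'
    have hne : i % l ≠ j % l := by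
      intro e
      apply hab
      rw [← hia, ← hjb]
      exact periodicSeq_congr r (by rw [Nat.add_mod, e, ← Nat.add_mod])
    refine (length_mul_entropyZero_le _).trans ?_
    refine mul_le_mul_of_nonneg_left ?_ (by positivity)
    have := length_followers_le (List.ofFn w) (periodicPrefix r n)
    refine le_trans (Nat.cast_le.2 this) (Nat.cast_le.2 (Finset.card_le_card ?_))
    intro x
    simp only [List.length_ofFn, length_periodicPrefix, Finset.mem_filter, Finset.mem_range]
    rintro ⟨hx, hxw, hxn⟩
    refine ⟨⟨hx, ?_⟩, hxw⟩
    by_cases hxi : x % l = i % l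
    · exact mem_badPositions_of_window r (hxi ▸ hne) (window_eq_iff r hxn.le hxw hjn.le hj)
    · exact mem_badPositions_of_window r hxi (window_eq_iff r hxn.le hxw hin.le hi)

theorem card_range_filter_ofNat_le (S : Finset (Fin l)) (n : ℕ) :
    ((Finset.range n).filter fun i => Fin.ofNat l i ∈ S).card ≤ (n / l + 1) * S.card := by
  have hl : 0 < l := NeZero.pos l
  rw [← Finset.card_range (n / l + 1), ← Finset.card_product]
  refine Finset.card_le_card_of_injOn (fun i => (i / l, Fin.ofNat l i)) ?_ ?_
  · intro i hi
    simp only [Finset.coe_filter, Finset.mem_range, Set.mem_ofPred_eq] at hi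
    simp only [Finset.coe_product, Set.mem_prod, Finset.mem_coe, Finset.mem_range]
    exact ⟨Nat.lt_succ_of_le (Nat.div_le_div_right hi.1.le), hi.2⟩
  · intro i _ j _ hij
    simp only [Prod.mk.injEq] at hij
    have h2 : i % l = j % l := congrArg Fin.val hij.2
    rw [← Nat.div_add_mod i l, ← Nat.div_add_mod j l, hij.1, h2]

/-- The empirical entropy of a periodic string is small if the period has few collisions. -/
theorem mul_empiricalEntropy_periodicPrefix_le (n k : ℕ) :
    (n : ℝ) * empiricalEntropy k (periodicPrefix r n) ≤
      2 * σ * ((n / l + 1 : ℕ) * (collisions r k).card) := by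
  rcases Nat.eq_zero_or_pos n with h0 | h0
  · subst h0; simp; positivity
  have h0' : (0 : ℝ) < n := by exact_mod_cast h0
  unfold empiricalEntropy
  rw [length_periodicPrefix, ← mul_assoc, mul_one_div_cancel h0'.ne', one_mul]
  refine (Finset.sum_le_sum fun w _ => length_mul_entropyZero_followers_le r n k w).trans ?_
  rw [← Finset.mul_sum]
  refine mul_le_mul_of_nonneg_left ?_ (by positivity)
  have h1 := card_range_filter_ofNat_le (badPositions r k) n
  have h2 : (badPositions r k).card ≤ (collisions r k).card := Finset.card_image_le
  -- Each position is an occurrence of at most one context, so it is counted at most once.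
  have h3 : ∑ w : Fin k → Fin σ,
      (((Finset.range n).filter fun i => Fin.ofNat l i ∈ badPositions r k).filter fun i =>
        ((periodicPrefix r n).drop i).take k = List.ofFn w).card ≤
      ((Finset.range n).filter fun i => Fin.ofNat l i ∈ badPositions r k).card := by
    classical
    rw [← Finset.card_biUnion]
    · refine Finset.card_le_card ?_
      intro x hx
      simp only [Finset.mem_biUnion] at hx
      obtain ⟨w, -, hw⟩ := hx
      exact (Finset.mem_filter.1 hw).1
    · intro w _ w' _ hww
      refine Finset.disjoint_left.2 fun x hx hx' => hww ?_
      exact List.ofFn_injective ((Finset.mem_filter.1 hx).2.symm.trans (Finset.mem_filter.1 hx').2)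
  exact_mod_cast h3.trans (h1.trans (Nat.mul_le_mul_left _ h2))

end Periodic

end Entropy

/-! ### The lower bound and the choice of parameters -/

/-- Finite form of the lower bound: some periodic string has small empirical entropy and cannot be
recovered from `n / 8` bits with `M` bits of memory. -/
theorem Decompressor.exists_hard_string {σ : ℕ} (hσ : 2 ≤ σ) (A : Decompressor σ) {n k l M : ℕ}
    {η : ℝ} (hη : 0 < η) (hl : 0 < l) (hk : 2 * k ≤ l) (hln : l ≤ n) (hM : 4 * M + 12 < 3 * l)
    (hlη : 2 * (l : ℝ) ≤ η * (σ : ℝ) ^ k) :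
    ∃ s : List (Fin σ), s.length = n ∧ (n : ℝ) * empiricalEntropy k s ≤ 4 * σ * η * n ∧
      ∀ e : List Bool, A.Recovers e s → A.UsesMemoryAtMost e M → n < 8 * e.length := by
  classical
  have : NeZero l := ⟨hl.ne'⟩
  set G := Finset.univ.filter fun r : Fin l → Fin σ => ((collisions r k).card : ℝ) ≤ η * l with hG
  have hp : 1 ≤ n / l := (Nat.one_le_div_iff hl).2 hln
  have hpl : n / l * l ≤ n := Nat.div_mul_le_self n l
  by_contra hcon
  push Not at hcon
  have hsmall : ∀ r ∈ G, ∃ e : List Bool, e.length ≤ n / 8 ∧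
      A.Recovers e (periodicPrefix r n) ∧ A.UsesMemoryAtMost e M := by
    intro r hr
    have hr' : ((collisions r k).card : ℝ) ≤ η * l := (Finset.mem_filter.1 hr).2
    obtain ⟨e, h1, h2, h3⟩ := hcon (periodicPrefix r n) (length_periodicPrefix r n) (by
      refine (mul_empiricalEntropy_periodicPrefix_le r n k).trans ?_
      have hp2 : ((n / l + 1 : ℕ) : ℝ) ≤ 2 * ((n / l : ℕ) : ℝ) := by
        exact_mod_cast (by omega : n / l + 1 ≤ 2 * (n / l))
      have hpl' : ((n / l : ℕ) : ℝ) * l ≤ n := by exact_mod_cast hpl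
      calc _ ≤ 2 * (σ : ℝ) * (2 * ((n / l : ℕ) : ℝ) * (η * l)) := by gcongr
        _ = 4 * σ * η * (((n / l : ℕ) : ℝ) * l) := by ring
        _ ≤ _ := by gcongr)
    exact ⟨e, by omega, h1, h2⟩
  have hcard := A.card_blocks_le hp G (fun r => periodicPrefix r n) (fun r => by simpa using hpl)
    (fun r i hi => block_periodicPrefix r hpl hi) hsmall
  have hhalf := half_le_card_few_collisions (σ := σ) hk hη hlη
  have hhalf' : σ ^ l ≤ 2 * G.card := by exact_mod_cast hhalf
  have hexp : 2 ^ l ≤ 2 ^ (M + 1 + (n / 8 / (n / l) + 1) + 1) := by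
    calc 2 ^ l ≤ σ ^ l := Nat.pow_le_pow_left hσ l
      _ ≤ 2 * G.card := hhalf'
      _ ≤ 2 * (2 ^ (M + 1) * 2 ^ (n / 8 / (n / l) + 1)) := Nat.mul_le_mul_left _ hcard
      _ = _ := by rw [pow_succ _ (_ + _), pow_add 2 (M + 1)]; ring
  have hle := (Nat.pow_le_pow_iff_right (by norm_num)).1 hexp
  -- At most l / 4 input bits fall to the cheap copy. Then `hle` gives l ≤ M + 3 + l / 4, against
  -- `hM`.
  have hdiv : 4 * (n / 8 / (n / l)) ≤ l := by
    set p := n / l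
    set q := n / 8 / p
    have h1 : q * p ≤ n / 8 := Nat.div_mul_le_self _ _
    have h2 : n < (p + 1) * l := by
      rw [mul_comm]; exact Nat.lt_mul_div_succ n hl
    have h3 : 8 * (n / 8) ≤ n := Nat.mul_div_le n 8
    have h4 : (p + 1) * l ≤ 2 * p * l := Nat.mul_le_mul_right _ (by omega)
    have h5 : p * (4 * q) ≤ p * l := by nlinarith
    exact Nat.le_of_mul_le_mul_left h5 hp
  omega

/-- Rounding the exponent up costs at most one factor `σ`. -/
theorem pow_ceil_mul_logb_bounds {σ : ℕ} (hσ : 2 ≤ σ) {a x : ℝ} (ha : 0 ≤ a) (hx : 1 ≤ x) :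
    x ^ a ≤ (σ : ℝ) ^ ⌈a * Real.logb σ x⌉₊ ∧ (σ : ℝ) ^ ⌈a * Real.logb σ x⌉₊ ≤ σ * x ^ a := by
  have hσ' : (1 : ℝ) < σ := by exact_mod_cast (by omega : 1 < σ)
  have hσ0 : (0 : ℝ) < σ := by linarith
  have hxa : x ^ a = (σ : ℝ) ^ (a * Real.logb σ x) := by
    rw [mul_comm, Real.rpow_mul hσ0.le, Real.rpow_logb hσ0 hσ'.ne' (by linarith)]
  have h0 : 0 ≤ a * Real.logb σ x := mul_nonneg ha (Real.logb_nonneg hσ' hx)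
  rw [hxa, ← Real.rpow_natCast]
  constructor
  · exact Real.rpow_le_rpow_of_exponent_le hσ'.le (Nat.le_ceil _)
  · calc _ ≤ (σ : ℝ) ^ (1 + a * Real.logb σ x) :=
          Real.rpow_le_rpow_of_exponent_le hσ'.le (by linarith [Nat.ceil_lt_add_one h0])
      _ = _ := by rw [Real.rpow_add hσ0, Real.rpow_one]

theorem theorem3 (σ : ℕ) (hσ : 2 ≤ σ) (c ε : ℝ) (hε : 0 < ε) (hεc : ε < c) (hc : c < 1 - ε)
    (C₁ C₂ : ℝ) :
    ∀ᶠ n : ℕ in atTop, ∀ A : Decompressor σ,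
      ∃ s : List (Fin σ), s.length = n ∧
        ∀ e : List Bool, A.Recovers e s → A.UsesMemoryAtMost e (C₁ * (n : ℝ) ^ c) →
          C₂ * ((n : ℝ) * empiricalEntropy ⌈(c + ε / 2) * Real.logb σ n⌉₊ s
              + (σ : ℝ) ^ ⌈(c + ε / 2) * Real.logb σ n⌉₊ * (n : ℝ) ^ (1 - c - ε))
            < (e.length : ℝ) := by
  have hσ' : (1 : ℝ) < σ := by exact_mod_cast (by omega : 1 < σ)
  have hσ0 : (0 : ℝ) < σ := by linarith
  have hc0 : 0 < c := hε.trans hεc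
  have hlogσ : 0 < Real.log σ := Real.log_pos hσ'
  -- Chosen so that (|C₂| + 1) · 4ση = 1/16, which makes the entropy term at most n / 16.
  set η : ℝ := 1 / (64 * σ * (|C₂| + 1)) with hη
  have hη0 : 0 < η := by positivity
  have hcast : Tendsto (fun n : ℕ => (n : ℝ)) atTop atTop := tendsto_natCast_atTop_atTop
  have hy := (tendsto_rpow_atTop (show 0 < ε / 4 by linarith)).comp hcast
  have hlog := hcast.eventually ((isLittleO_log_rpow_atTop (show 0 < c + ε / 4 by linarith)).bound
    (show 0 < Real.log σ / (4 * (c + ε / 2)) by positivity))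
  -- With y = n^(ε/4), the bounds on y serve in turn for `hM`, `hlη` and `hB`; the logarithmic bound
  -- gives `hkle`.
  filter_upwards [eventually_ge_atTop 1, hy.eventually_ge_atTop (4 * |C₁| + 12),
    hy.eventually_ge_atTop (4 / η), hy.eventually_ge_atTop (16 * |C₂| * σ), hlog]
    with n hn h1 h2 h3 h4 A
  simp only [Function.comp_apply] at h1 h2 h3
  have hx1 : (1 : ℝ) ≤ n := by exact_mod_cast hn
  have hx0 : (0 : ℝ) < n := by linarith
  set x : ℝ := (n : ℝ) with hx
  set k := ⌈(c + ε / 2) * Real.logb σ x⌉₊ with hk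
  set y := x ^ (ε / 4) with hydef
  have hy12 : 12 ≤ y := by linarith [abs_nonneg C₁]
  obtain ⟨hkl, hku⟩ := pow_ceil_mul_logb_bounds hσ (show 0 ≤ c + ε / 2 by linarith) hx1
  rw [← hk] at hkl hku
  have hxc : 1 ≤ x ^ c := Real.one_le_rpow hx1 (by linarith)
  have e1 : x ^ (c + ε / 4) = x ^ c * y := Real.rpow_add hx0 _ _
  have e2 : x ^ (c + ε / 2) = x ^ (c + ε / 4) * y := by
    rw [hydef, ← Real.rpow_add hx0]; congr 1; ring
  have hyl : y ≤ x ^ (c + ε / 4) := by rw [e1]; nlinarith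
  set l := ⌈x ^ (c + ε / 4)⌉₊ with hl
  have hl1 : x ^ (c + ε / 4) ≤ l := Nat.le_ceil _
  have hl2 : (l : ℝ) ≤ 2 * x ^ (c + ε / 4) := by
    have := Nat.ceil_lt_add_one (show 0 ≤ x ^ (c + ε / 4) by positivity)
    linarith
  have hlpos : 0 < l := by
    have : (0 : ℝ) < l := by linarith
    exact_mod_cast this
  have hkle : 2 * k ≤ l := by
    have h0 : 0 ≤ (c + ε / 2) * Real.logb σ x :=
      mul_nonneg (by linarith) (Real.logb_nonneg hσ' hx1)
    have hk1 : (k : ℝ) < (c + ε / 2) * Real.logb σ x + 1 := Nat.ceil_lt_add_one h0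
    rw [Real.norm_eq_abs, Real.norm_eq_abs, abs_of_nonneg (Real.log_nonneg hx1),
      abs_of_nonneg (by positivity)] at h4
    have h5 : (c + ε / 2) * Real.logb σ x ≤ x ^ (c + ε / 4) / 4 := by
      have hcε : 0 < c + ε / 2 := by linarith
      calc (c + ε / 2) * Real.logb σ x
          ≤ (c + ε / 2) * ((Real.log σ / (4 * (c + ε / 2)) * x ^ (c + ε / 4)) / Real.log σ) := by
            unfold Real.logb; gcongr
        _ = _ := by field_simp
    have : (2 * k : ℝ) ≤ l := by linarith
    exact_mod_cast this
  have hln : l ≤ n := by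
    refine Nat.ceil_le.2 ?_
    calc x ^ (c + ε / 4) ≤ x ^ (1 : ℝ) := Real.rpow_le_rpow_of_exponent_le hx1 (by linarith)
      _ = n := Real.rpow_one x
  have hM : 4 * ⌊|C₁| * x ^ c⌋₊ + 12 < 3 * l := by
    have hf : (⌊|C₁| * x ^ c⌋₊ : ℝ) ≤ |C₁| * x ^ c := Nat.floor_le (by positivity)
    have : x ^ c * (4 * |C₁| + 12) ≤ x ^ c * y := by gcongr
    have hlt : (4 * ⌊|C₁| * x ^ c⌋₊ + 12 : ℝ) < 3 * l := by nlinarith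
    exact_mod_cast hlt
  have hlη : 2 * (l : ℝ) ≤ η * (σ : ℝ) ^ k := by
    have h5 : 4 ≤ η * y := by rwa [div_le_iff₀' hη0] at h2
    calc 2 * (l : ℝ) ≤ 4 * x ^ (c + ε / 4) := by linarith
      _ ≤ (η * y) * x ^ (c + ε / 4) := by gcongr
      _ = η * x ^ (c + ε / 2) := by rw [e2]; ring
      _ ≤ _ := by gcongr
  obtain ⟨s, hs, hH, hs'⟩ := A.exists_hard_string hσ hη0 hlpos hkle hln hM hlη
  refine ⟨s, hs, fun e he hmem => ?_⟩
  have hlen := hs' e he (fun z hz => by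
    refine Nat.cast_le.2 (Nat.le_floor ((hmem z hz).trans ?_))
    gcongr
    exact le_abs_self C₁)
  have hlen' : x < 8 * (e.length : ℝ) := by rw [hx]; exact_mod_cast hlen
  have hE : 0 ≤ x * empiricalEntropy k s := mul_nonneg hx0.le (empiricalEntropy_nonneg k s)
  have hA : |C₂| * (x * empiricalEntropy k s) ≤ x / 16 := by
    calc _ ≤ (|C₂| + 1) * (4 * σ * η * x) :=
          mul_le_mul (by linarith) hH hE (by positivity)
      _ = x / 16 := by rw [hη]; field_simp; norm_num
  -- The left side is at most |C₂| σ n^(1-ε/2), and y² = n^(ε/2) absorbs the constants.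
  have hB : |C₂| * ((σ : ℝ) ^ k * x ^ (1 - c - ε)) ≤ x / 16 := by
    have e3 : x ^ (c + ε / 2) * x ^ (1 - c - ε) * (y * y) = x := by
      rw [hydef, ← Real.rpow_add hx0, ← Real.rpow_add hx0, ← Real.rpow_add hx0]
      calc _ = x ^ (1 : ℝ) := by congr 1; ring
        _ = x := Real.rpow_one x
    have h6 : 16 * |C₂| * σ ≤ y * y := by nlinarith
    calc |C₂| * ((σ : ℝ) ^ k * x ^ (1 - c - ε))
        ≤ |C₂| * ((σ * x ^ (c + ε / 2)) * x ^ (1 - c - ε)) := by gcongr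
      _ = x ^ (c + ε / 2) * x ^ (1 - c - ε) * (16 * |C₂| * σ) / 16 := by ring
      _ ≤ x ^ (c + ε / 2) * x ^ (1 - c - ε) * (y * y) / 16 := by gcongr
      _ = x / 16 := by rw [e3]
  calc C₂ * (x * empiricalEntropy k s + (σ : ℝ) ^ k * x ^ (1 - c - ε))
      ≤ |C₂| * (x * empiricalEntropy k s + (σ : ℝ) ^ k * x ^ (1 - c - ε)) :=
        mul_le_mul_of_nonneg_right (le_abs_self _) (by positivity)
    _ < e.length := by linarith
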